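/- For $\alpha>0$, $x\in(0,1)$ and $n\in\mathbb N=\{1,2,\dots\}$, let $\mu^{(n)}_{\alpha,x}$ be the $\alpha$-fractional binomial distribution, i.e. the probability measure on $\{0,1,\dots,n\}$ $$\mu^{(n)}_{\alpha,x}=\frac{\alpha}{Z^{(n)}_{\alpha,x}}\sum_{j=0}^n\binom{\alpha n}{\alpha j}x^{\alpha j}(1-x)^{\alpha(n-j)}\delta_j,\qquad Z^{(n)}_{\alpha,x}=\alpha\sum_{j=0}^n\binom{\alpha n}{\alpha j}x^{\alpha j}(1-x)^{\alpha(n-j)},$$ where $\binom{w}{z}=\frac{\Gamma(w+1)}{\Gamma(z+1)\Gamma(w-z+1)}$ and $\delta_j$ is the Dirac measure at $j$. Let $S^{(n)}_{\alpha,x}$ be a random variable with law $\mu^{(n)}_{\alpha,x}$. **Theorem.** Let $\alpha>0$ and $x\in(0,1)$, and let $(c_n)_{n\ge1}$ be a sequence of positive numbers with $c_n/n\to0$ and $c_n/\sqrt n\to\infty$ as $n\to\infty$. Put $Y^{(n)}_{\alpha,x}=(S^{(n)}_{\alpha,x}-nx)/c_n$. Then the sequence of laws of $Y^{(n)}_{\alpha,x}$,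 $n\in\mathbb N$, satisfies the moderate deviation principle (that is, the large deviation principle on $\mathbb R$) with speed $c_n^2/n$ (a positive sequence tending to $\infty$) and with the lower semicontinuous rate function $$I(z)=\frac{\alpha}{2x(1-x)}z^2,\qquad z\in\mathbb R.$$ Namely, with the conventions $\log0=-\infty$ and $\inf\emptyset=+\infty$: 1. for every closed set $F\subset\mathbb R$, $\displaystyle\limsup_{n\to\infty}\frac{n}{c_n^2}\log\mathbb P\bigl(Y^{(n)}_{\alpha,x}\in F\bigr)\le-\inf_{z\in F}I(z)$; 2. for every open set $G\subset\mathbb R$, $\displaystyle\liminf_{n\to\infty}\frac{n}{c_n^2}\log\mathbb P\bigl(Y^{(n)}_{\alpha,x}\in G\bigr)\ge-\inf_{z\in G}I(z)$. -/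

import Mathlib

open MeasureTheory ProbabilityTheory Filter Topology
open scoped ENNReal

noncomputable section

/-- The generalized binomial coefficient `Γ(w+1) / (Γ(z+1) Γ(w-z+1))`. Mathlib's `Real.Gamma`
vanishes at its poles, so the quotient is `0` whenever a pole occurs in the denominator. -/
def genBinom (w z : ℝ) : ℝ :=
  Real.Gamma (w + 1) / (Real.Gamma (z + 1) * Real.Gamma (w - z + 1))

/-- The unnormalized weight `binom(αn, αj) x^(αj) (1-x)^(α(n-j))`. -/
def fracWeight (α x : ℝ) (n j : ℕ) : ℝ :=
  genBinom (α * n) (α * j) * x ^ (α * (j : ℝ)) * (1 - x) ^ (α * ((n : ℝ) - (j : ℝ)))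

/-- The normalizing constant `Z = α ∑_{j=0}^n binom(αn, αj) x^(αj) (1-x)^(α(n-j))`. -/
def fracZ (α x : ℝ) (n : ℕ) : ℝ :=
  α * ∑ j ∈ Finset.range (n + 1), fracWeight α x n j

/-- The `α`-fractional binomial distribution with parameters `n` and `x`, as a measure on `ℝ`
carried by `{0, 1, …, n}`. -/
def fracBinomial (α x : ℝ) (n : ℕ) : Measure ℝ :=
  ∑ j ∈ Finset.range (n + 1),
    ENNReal.ofReal (α / fracZ α x n * fracWeight α x n j) • Measure.dirac (j : ℝ)

/-- The sequence `μ n`, `n ≥ 1`, of Borel probability measures on `ℝ` satisfies the large deviation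
principle with speed `a n` and rate function `I`. Logarithms are extended by `log 0 = -∞`, and
the infimum over the empty set is `+∞`. The values at `n = 0` play no role. -/
structure SatisfiesLDP (μ : ℕ → Measure ℝ) (a : ℕ → ℝ) (I : ℝ → ℝ≥0∞) : Prop where
  isProbabilityMeasure : ∀ n, 1 ≤ n → IsProbabilityMeasure (μ n)
  speed_pos : ∀ n, 1 ≤ n → 0 < a n
  speed_tendsto : Tendsto a atTop atTop
  lowerSemicontinuous : LowerSemicontinuous I
  upper_bound : ∀ F : Set ℝ, IsClosed F →
    limsup (fun n => ((1 / a n : ℝ) : EReal) * ENNReal.log (μ n F)) atTop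
      ≤ -(⨅ z ∈ F, (I z : EReal))
  lower_bound : ∀ G : Set ℝ, IsOpen G →
    -(⨅ z ∈ G, (I z : EReal))
      ≤ liminf (fun n => ((1 / a n : ℝ) : EReal) * ENNReal.log (μ n G)) atTop

end

/-! Write `β = α / (2 * x * (1 - x))`. Since `log Γ` is convex and its derivative at `s + 1` lies
between `log s` and `log (s + 1)`, the logarithm `logWeight` of the weight is concave and equals its
value at `n * x` minus `β * v ^ 2 / n` at `n * x + v`, up to `o(c n ^ 2 / n)` uniformly for `|v| =
O(c n)`.

Probabilities are compared by integer shifts, so the normalizing constant cancels and needs no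
asymptotics. Upper bound: moving the tail beyond `z * c n` back by `k ≈ z * c n` changes each
log-weight, by concavity, at least as much as moving `n * x + k` to `n * x`; the shifted mass is at
most `1`, hence `eventually_fracBinomial_tail_le`. Lower bound: that estimate puts mass at least
`1/2` in a small window around the mean, and shifting the window to `z * c n` costs about `β * z ^ 2
* (c n ^ 2 / n)`, hence `eventually_le_fracBinomial_interval`. These two Gaussian bounds imply the
principle. -/

noncomputable section

/-! ### Convexity and logarithmic derivative of Gamma -/

/-- Increments of a convex function over intervals of equal length are monotone. -/
theorem ConvexOn.add_le_add_of_shift {s : Set ℝ} {f : ℝ → ℝ} (hf : ConvexOn ℝ s f) {a b k : ℝ}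
    (ha : a ∈ s) (hbk : b + k ∈ s) (hab : a ≤ b) (hk : 0 ≤ k) :
    f (a + k) + f b ≤ f a + f (b + k) := by
  rcases (add_nonneg (sub_nonneg.2 hab) hk).eq_or_lt with h | h
  · obtain rfl : k = 0 := by linarith
    simp
  -- `a + k` and `b` are convex combinations of `a` and `b + k` with swapped weights, so the two
  -- inequalities add up.
  have h1 := hf.2 ha hbk (div_nonneg (sub_nonneg.2 hab) h.le) (div_nonneg hk h.le)
    (by field_simp)
  have h2 := hf.2 ha hbk (div_nonneg hk h.le) (div_nonneg (sub_nonneg.2 hab) h.le)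
    (by field_simp; ring)
  simp only [smul_eq_mul] at h1 h2
  rw [show (b - a) / (b - a + k) * a + k / (b - a + k) * (b + k) = a + k by
    field_simp; ring] at h1
  rw [show k / (b - a + k) * a + (b - a) / (b - a + k) * (b + k) = b by
    field_simp; ring] at h2
  have h3 : (b - a) / (b - a + k) + k / (b - a + k) = 1 := by field_simp
  have h4 : ((b - a) / (b - a + k) + k / (b - a + k)) * (f a + f (b + k)) = f a + f (b + k) := by
    rw [h3, one_mul]
  linarith

/-- The logarithm of the Gamma function satisfies `log s ≤ (log Γ)' (s + 1) ≤ log (s + 1)`. -/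
theorem exists_hasDerivAt_log_Gamma {s : ℝ} (hs : 0 < s) :
    ∃ d, HasDerivAt (fun t => Real.log (Real.Gamma t)) d (s + 1) ∧
      Real.log s ≤ d ∧ d ≤ Real.log (s + 1) := by
  have hd : DifferentiableAt ℝ (fun t => Real.log (Real.Gamma t)) (s + 1) := by
    refine (Real.differentiableAt_Gamma fun m => ?_).log (Real.Gamma_pos_of_pos (by linarith)).ne'
    have : (0 : ℝ) ≤ m := m.cast_nonneg
    linarith
  have hfun : ∀ t : ℝ, 0 < t →
      Real.log (Real.Gamma (t + 1)) = Real.log t + Real.log (Real.Gamma t) := fun t ht => by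
    rw [Real.Gamma_add_one ht.ne', Real.log_mul ht.ne' (Real.Gamma_pos_of_pos ht).ne']
  have hc : ConvexOn ℝ (Set.Ioi 0) (fun t => Real.log (Real.Gamma t)) := Real.convexOn_log_Gamma
  refine ⟨_, hd.hasDerivAt, ?_, ?_⟩
  -- By the functional equation, the chord of `log Γ` over `[s, s + 1]` has slope exactly `log s`.
  · have := hc.slope_le_of_hasDerivAt (x := s) (y := s + 1) hs (Set.mem_Ioi.2 (by linarith))
      (by linarith) hd.hasDerivAt
    rw [slope_def_field, hfun s hs] at this
    simpa using this
  · have := hc.le_slope_of_hasDerivAt (x := s + 1) (y := s + 1 + 1) (Set.mem_Ioi.2 (by linarith))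
      (Set.mem_Ioi.2 (by linarith)) (by linarith) hd.hasDerivAt
    rw [slope_def_field, hfun (s + 1) (by linarith)] at this
    simpa using this

theorem abs_log_one_add_sub_le {q : ℝ} (hq : |q| ≤ 1 / 2) : |Real.log (1 + q) - q| ≤ 2 * q ^ 2 := by
  obtain ⟨h1, h2⟩ := abs_le.1 hq
  have hpos : 0 < 1 + q := by linarith
  have hu := Real.log_le_sub_one_of_pos hpos
  have hl := Real.one_sub_inv_le_log_of_pos hpos
  have : q - 2 * q ^ 2 ≤ 1 - (1 + q)⁻¹ := by
    rw [show 1 - (1 + q)⁻¹ = q / (1 + q) by field_simp; ring, le_div_iff₀ hpos]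
    nlinarith [mul_nonneg (sq_nonneg q) (show 0 ≤ 1 + 2 * q by linarith)]
  rw [abs_le]
  constructor <;> nlinarith [sq_nonneg q]

/-! ### Concavity and quadratic expansion of the log-weights -/

/-- The part of the logarithm of `fracWeight α x n y` that depends on `y`. -/
def logWeight (α x n y : ℝ) : ℝ :=
  -(Real.log (Real.Gamma (α * y + 1)) + Real.log (Real.Gamma (α * (n - y) + 1)))
    + α * y * Real.log x + α * (n - y) * Real.log (1 - x)

/-- Both Gamma terms are convex in `y`, and the terms with `log x` and `log (1 - x)` are affine and
cancel. The points are real, so integer sites can be compared with the mean `n * x`. -/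
theorem logWeight_add_le_add_of_shift {α x n a b k : ℝ} (hα : 0 ≤ α) (ha : 0 ≤ a)
    (hbk : b + k ≤ n) (hab : a ≤ b) (hk : 0 ≤ k) :
    logWeight α x n a + logWeight α x n (b + k)
      ≤ logWeight α x n (a + k) + logWeight α x n b := by
  have hc : ConvexOn ℝ (Set.Ioi 0) (fun t => Real.log (Real.Gamma t)) := Real.convexOn_log_Gamma
  have pos : ∀ t : ℝ, 0 ≤ t → α * t + 1 ∈ Set.Ioi (0 : ℝ) := fun t ht => by
    have := mul_nonneg hα ht
    exact Set.mem_Ioi.2 (by linarith)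
  have h1 := hc.add_le_add_of_shift (a := α * a + 1) (b := α * b + 1) (k := α * k) (pos a ha)
    (by convert pos (b + k) (by linarith) using 1; ring) (by gcongr) (by positivity)
  have h2 := hc.add_le_add_of_shift (a := α * (n - (b + k)) + 1) (b := α * (n - (a + k)) + 1)
    (k := α * k) (pos _ (by linarith))
    (by convert pos (n - a) (by linarith) using 1; ring) (by gcongr) (by positivity)
  rw [show α * a + 1 + α * k = α * (a + k) + 1 by ring,
    show α * b + 1 + α * k = α * (b + k) + 1 by ring] at h1
  rw [show α * (n - (b + k)) + 1 + α * k = α * (n - b) + 1 by ring,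
    show α * (n - (a + k)) + 1 + α * k = α * (n - a) + 1 by ring] at h2
  unfold logWeight
  linarith

/-- Replacing each derivative of `log Γ` by a logarithm costs `O(1 / n)`; expanding `log (1 + v / (n
* x))` and its mirror image costs `O(v ^ 2 / n ^ 2)`. The constant logarithms cancel. -/
theorem exists_hasDerivAt_logWeight {α x n v : ℝ} (hα : 0 < α) (hx0 : 0 < x) (hx1 : x < 1)
    (hn : 0 < n) (hvx : |v| ≤ n * x / 2) (hvx' : |v| ≤ n * (1 - x) / 2) :
    ∃ d, HasDerivAt (logWeight α x n) d (n * x + v) ∧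
      |d + α / (x * (1 - x)) * (v / n)|
        ≤ 2 * α * (1 / x ^ 2 + 1 / (1 - x) ^ 2) * (v ^ 2 / n ^ 2)
          + (2 / x + 2 / (1 - x)) * (1 / n) := by
  have hx1' : 0 < 1 - x := by linarith
  obtain ⟨hv1, hv2⟩ := abs_le.1 hvx
  obtain ⟨hv3, hv4⟩ := abs_le.1 hvx'
  have hnx : 0 < n * x := by positivity
  have hnx' : 0 < n * (1 - x) := by positivity
  set y := n * x + v with hy
  have hy1 : n * x / 2 ≤ y := by linarith
  have hy2 : n * (1 - x) / 2 ≤ n - y := by linarith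
  have hy0 : 0 < y := by linarith
  have hy0' : 0 < n - y := by linarith
  obtain ⟨d1, hd1, hl1, hu1⟩ := exists_hasDerivAt_log_Gamma (mul_pos hα hy0)
  obtain ⟨d2, hd2, hl2, hu2⟩ := exists_hasDerivAt_log_Gamma (mul_pos hα hy0')
  have e1 : HasDerivAt (fun t : ℝ => α * t + 1) α y := by
    simpa using ((hasDerivAt_id y).const_mul α).add_const 1
  have e2 : HasDerivAt (fun t : ℝ => α * (n - t) + 1) (-α) y := by
    simpa using (((hasDerivAt_id y).const_sub n).const_mul α).add_const 1
  have e3 : HasDerivAt (fun t : ℝ => α * t * Real.log x) (α * Real.log x) y := by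
    simpa using ((hasDerivAt_id y).const_mul α).mul_const (Real.log x)
  have e4 : HasDerivAt (fun t : ℝ => α * (n - t) * Real.log (1 - x)) (-α * Real.log (1 - x)) y := by
    simpa using (((hasDerivAt_id y).const_sub n).const_mul α).mul_const (Real.log (1 - x))
  have hD := (((hd1.comp y e1).add (hd2.comp y e2)).neg.add e3).add e4
  refine ⟨_, hD, ?_⟩
  have err : ∀ t d : ℝ, 0 < t → Real.log (α * t) ≤ d → d ≤ Real.log (α * t + 1) →
      0 ≤ d - Real.log (α * t) ∧ α * (d - Real.log (α * t)) ≤ 1 / t := by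
    intro t d ht h1 h2
    refine ⟨by linarith, ?_⟩
    have hat := mul_pos hα ht
    have h3 : Real.log (α * t + 1) - Real.log (α * t) ≤ 1 / (α * t) := by
      rw [← Real.log_div (by positivity) hat.ne']
      refine (Real.log_le_sub_one_of_pos (by positivity)).trans (le_of_eq ?_)
      field_simp
      ring
    calc α * (d - Real.log (α * t)) ≤ α * (1 / (α * t)) := by gcongr; linarith
      _ = 1 / t := by field_simp
  obtain ⟨a1, b1⟩ := err y d1 hy0 hl1 hu1
  obtain ⟨a2, b2⟩ := err (n - y) d2 hy0' hl2 hu2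
  have a1' := mul_nonneg hα.le a1
  have a2' := mul_nonneg hα.le a2
  have b1' : 1 / y ≤ 2 / x * (1 / n) := by
    rw [show 2 / x * (1 / n) = 1 / (n * x / 2) by field_simp]
    exact one_div_le_one_div_of_le (by positivity) hy1
  have b2' : 1 / (n - y) ≤ 2 / (1 - x) * (1 / n) := by
    rw [show 2 / (1 - x) * (1 / n) = 1 / (n * (1 - x) / 2) by field_simp]
    exact one_div_le_one_div_of_le (by positivity) hy2
  have hq : |v / (n * x)| ≤ 1 / 2 := by
    rw [abs_div, abs_of_pos hnx, div_le_iff₀ hnx]; linarith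
  have hp : |-v / (n * (1 - x))| ≤ 1 / 2 := by
    rw [abs_div, abs_of_pos hnx', abs_neg, div_le_iff₀ hnx']; linarith
  have lq := abs_log_one_add_sub_le hq
  have lp := abs_log_one_add_sub_le hp
  have k1 : Real.log (α * y)
      = Real.log α + Real.log n + Real.log x + Real.log (1 + v / (n * x)) := by
    have : 0 < 1 + v / (n * x) := by linarith [(abs_le.1 hq).1]
    rw [← Real.log_mul hα.ne' hn.ne', ← Real.log_mul (by positivity) hx0.ne',
      ← Real.log_mul (by positivity) this.ne', hy]
    congr 1
    field_simp
  have k2 : Real.log (α * (n - y))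
      = Real.log α + Real.log n + Real.log (1 - x) + Real.log (1 + -v / (n * (1 - x))) := by
    have : 0 < 1 + -v / (n * (1 - x)) := by linarith [(abs_le.1 hp).1]
    rw [← Real.log_mul hα.ne' hn.ne', ← Real.log_mul (by positivity) hx1'.ne',
      ← Real.log_mul (by positivity) this.ne', hy]
    congr 1
    field_simp
    ring
  set A := Real.log (1 + v / (n * x)) - v / (n * x) with hA
  set B := Real.log (1 + -v / (n * (1 - x))) - -v / (n * (1 - x)) with hB
  have main : -(d1 * α + d2 * -α) + α * Real.log x + -α * Real.log (1 - x)
      + α / (x * (1 - x)) * (v / n)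
      = α * B - α * A + α * (d2 - Real.log (α * (n - y))) - α * (d1 - Real.log (α * y)) := by
    rw [k1, k2, hA, hB,
      show α / (x * (1 - x)) * (v / n) = α * (v / (n * x)) - α * (-v / (n * (1 - x))) by
        field_simp; ring]
    ring
  rw [main]
  have lA := abs_le.1 lq
  have lB := abs_le.1 lp
  have sA := mul_le_mul_of_nonneg_left lq hα.le
  have sB := mul_le_mul_of_nonneg_left lp hα.le
  have expand : 2 * α * (1 / x ^ 2 + 1 / (1 - x) ^ 2) * (v ^ 2 / n ^ 2)
      = α * (2 * (v / (n * x)) ^ 2) + α * (2 * (-v / (n * (1 - x))) ^ 2) := by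
    field_simp
  rw [expand, add_mul, abs_le]
  have m1 := mul_le_mul_of_nonneg_left lA.1 hα.le
  have m2 := mul_le_mul_of_nonneg_left lA.2 hα.le
  have m3 := mul_le_mul_of_nonneg_left lB.1 hα.le
  have m4 := mul_le_mul_of_nonneg_left lB.2 hα.le
  constructor <;> linarith

/-- Quadratic approximation of the logarithm of the weights near the mean. -/
theorem abs_logWeight_sub_add_sq_le {α x n v : ℝ} (hα : 0 < α) (hx0 : 0 < x) (hx1 : x < 1)
    (hn : 0 < n) (hvx : |v| ≤ n * x / 2) (hvx' : |v| ≤ n * (1 - x) / 2) :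
    |logWeight α x n (n * x + v) - logWeight α x n (n * x) + α / (2 * x * (1 - x)) * (v ^ 2 / n)|
      ≤ (2 * α * (1 / x ^ 2 + 1 / (1 - x) ^ 2) * (v ^ 2 / n ^ 2)
          + (2 / x + 2 / (1 - x)) * (1 / n)) * |v| := by
  have hx1' : 0 < 1 - x := by linarith
  -- The derivative bound at `u` is at most the one at `v`, so the mean value inequality applies on
  -- the whole segment.
  have key : ∀ u ∈ Set.Icc (-|v|) |v|, ∃ d,
      HasDerivAt (fun u => logWeight α x n (n * x + u) + α / (2 * x * (1 - x)) * (u ^ 2 / n)) d u ∧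
      |d| ≤ 2 * α * (1 / x ^ 2 + 1 / (1 - x) ^ 2) * (v ^ 2 / n ^ 2)
          + (2 / x + 2 / (1 - x)) * (1 / n) := by
    intro u hu
    have hu' : |u| ≤ |v| := abs_le.2 hu
    obtain ⟨d, hd, hb⟩ := exists_hasDerivAt_logWeight hα hx0 hx1 hn (hu'.trans hvx)
      (hu'.trans hvx')
    have h1 : HasDerivAt (fun u : ℝ => α / (2 * x * (1 - x)) * (u ^ 2 / n))
        (α / (x * (1 - x)) * (u / n)) u := by
      refine (((hasDerivAt_pow 2 u).div_const n).const_mul (α / (2 * x * (1 - x)))).congr_deriv ?_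
      simp only [Nat.cast_ofNat, Nat.add_one_sub_one, pow_one]
      field_simp
    refine ⟨_, (hd.comp_const_add (n * x) u).add h1, hb.trans ?_⟩
    have : u ^ 2 ≤ v ^ 2 := sq_le_sq.2 hu'
    gcongr
  choose! d hd hb using key
  have := (convex_Icc (-|v|) |v|).norm_image_sub_le_of_norm_hasDerivWithin_le
    (fun u hu => (hd u hu).hasDerivWithinAt) hb (x := 0) (y := v)
    ⟨by simp, by simp⟩ ⟨neg_abs_le v, le_abs_self v⟩
  simp only [Real.norm_eq_abs, sub_zero, add_zero, zero_div, mul_zero, ne_eq,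
    OfNat.ofNat_ne_zero, not_false_eq_true, zero_pow] at this
  convert this using 2
  ring

/-! ### The moderate scale -/

theorem tendsto_atTop_of_div_sqrt {c : ℕ → ℝ}
    (hc_sqrt : Tendsto (fun n : ℕ => c n / √(n : ℝ)) atTop atTop) : Tendsto c atTop atTop := by
  have h := hc_sqrt.atTop_mul_atTop₀
    (Real.tendsto_sqrt_atTop.comp tendsto_natCast_atTop_atTop)
  refine h.congr' ?_
  filter_upwards [eventually_ge_atTop 1] with n hn
  have : (0 : ℝ) < √(n : ℝ) := Real.sqrt_pos.2 (by exact_mod_cast hn)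
  simp only [Function.comp_apply]
  field_simp

theorem tendsto_sq_div_atTop {c : ℕ → ℝ}
    (hc_sqrt : Tendsto (fun n : ℕ => c n / √(n : ℝ)) atTop atTop) :
    Tendsto (fun n : ℕ => c n ^ 2 / n) atTop atTop := by
  refine (hc_sqrt.atTop_mul_atTop₀ hc_sqrt).congr fun n => ?_
  rw [div_mul_div_comm, Real.mul_self_sqrt n.cast_nonneg, sq]

/-- On the scale `c n`, the logarithm of the weights is quadratic up to `o(c n ^ 2 / n)`. -/
theorem eventually_abs_logWeight_sub_add_sq_le {α x : ℝ} (hα : 0 < α) (hx0 : 0 < x) (hx1 : x < 1)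
    {c : ℕ → ℝ} (hc_n : Tendsto (fun n : ℕ => c n / (n : ℝ)) atTop (𝓝 0))
    (hc_sqrt : Tendsto (fun n : ℕ => c n / √(n : ℝ)) atTop atTop) {M δ : ℝ} (hM : 0 < M)
    (hδ : 0 < δ) :
    ∀ᶠ n : ℕ in atTop, ∀ v : ℝ, |v| ≤ M * c n →
      |v| ≤ n * x / 2 ∧ |v| ≤ n * (1 - x) / 2 ∧
      |logWeight α x n (n * x + v) - logWeight α x n (n * x)
        + α / (2 * x * (1 - x)) * (v ^ 2 / n)| ≤ δ * (c n ^ 2 / n) := by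
  have hx1' : 0 < 1 - x := by linarith
  have hc := tendsto_atTop_of_div_sqrt hc_sqrt
  set K₁ := 2 * α * (1 / x ^ 2 + 1 / (1 - x) ^ 2) with hK₁
  set K₂ := 2 / x + 2 / (1 - x) with hK₂
  -- This is the error divided by `c n ^ 2 / n`: the Taylor part vanishes because `c n / n → 0`, the
  -- Gamma part because `c n → ∞`.
  have lim : Tendsto (fun n : ℕ => K₁ * M ^ 3 * (c n / n) + K₂ * M * (c n)⁻¹) atTop (𝓝 0) := by
    simpa using (hc_n.const_mul (K₁ * M ^ 3)).add (hc.inv_tendsto_atTop.const_mul (K₂ * M))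
  have limM : Tendsto (fun n : ℕ => M * (c n / n)) atTop (𝓝 0) := by simpa using hc_n.const_mul M
  filter_upwards [eventually_gt_atTop 0, hc.eventually_gt_atTop 0, lim.eventually_le_const hδ,
    limM.eventually_le_const (half_pos hx0), limM.eventually_le_const (half_pos hx1')]
    with n hn hcn h1 h2 h3 v hv
  have hn' : (0 : ℝ) < n := by exact_mod_cast hn
  have hMc : M * c n = n * (M * (c n / n)) := by field_simp
  have hv1 : |v| ≤ n * x / 2 := by
    rw [hMc] at hv; nlinarith [mul_le_mul_of_nonneg_left h2 hn'.le]
  have hv2 : |v| ≤ n * (1 - x) / 2 := by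
    rw [hMc] at hv; nlinarith [mul_le_mul_of_nonneg_left h3 hn'.le]
  refine ⟨hv1, hv2, (abs_logWeight_sub_add_sq_le hα hx0 hx1 hn' hv1 hv2).trans ?_⟩
  have hv3 : v ^ 2 ≤ (M * c n) ^ 2 := by rw [← sq_abs v]; gcongr
  calc (K₁ * (v ^ 2 / n ^ 2) + K₂ * (1 / n)) * |v|
      ≤ (K₁ * ((M * c n) ^ 2 / n ^ 2) + K₂ * (1 / n)) * (M * c n) := by gcongr
    _ = (K₁ * M ^ 3 * (c n / n) + K₂ * M * (c n)⁻¹) * (c n ^ 2 / n) := by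
        field_simp
    _ ≤ δ * (c n ^ 2 / n) := by gcongr

/-! ### The law through its log-weights, and shifts -/

theorem fracWeight_eq_mul_exp_logWeight {α x : ℝ} (hα : 0 ≤ α) (hx0 : 0 < x) (hx1 : x < 1)
    {n j : ℕ} (hj : j ≤ n) :
    fracWeight α x n j = Real.Gamma (α * n + 1) * Real.exp (logWeight α x n j) := by
  have hj' : (0 : ℝ) ≤ n - j := sub_nonneg.2 (by exact_mod_cast hj)
  have g1 : 0 < Real.Gamma (α * j + 1) := Real.Gamma_pos_of_pos (by positivity)
  have g2 : 0 < Real.Gamma (α * (n - j) + 1) := Real.Gamma_pos_of_pos (by positivity)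
  unfold fracWeight genBinom logWeight
  rw [Real.exp_add, Real.exp_add, Real.exp_neg, Real.exp_add, Real.exp_log g1, Real.exp_log g2,
    Real.rpow_def_of_pos hx0, Real.rpow_def_of_pos (by linarith), mul_sub,
    mul_comm (Real.log x), mul_comm (Real.log (1 - x))]
  ring

open Classical in
theorem fracBinomial_apply {α x : ℝ} (hα : 0 < α) (hx0 : 0 < x) (hx1 : x < 1) (n : ℕ)
    {A : Set ℝ} (hA : MeasurableSet A) :
    fracBinomial α x n A = ENNReal.ofReal
      ((∑ j ∈ Finset.range (n + 1) with (j : ℕ) ∈ ((↑) ⁻¹' A : Set ℕ),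
          Real.exp (logWeight α x n (j : ℕ)))
        / ∑ j ∈ Finset.range (n + 1), Real.exp (logWeight α x n (j : ℕ))) := by
  have hG : 0 < Real.Gamma (α * n + 1) := Real.Gamma_pos_of_pos (by positivity)
  have hZ : fracZ α x n = α * (Real.Gamma (α * n + 1)
      * ∑ j ∈ Finset.range (n + 1), Real.exp (logWeight α x n (j : ℕ))) := by
    rw [fracZ, Finset.mul_sum _ _ (Real.Gamma _)]
    congr 1
    exact Finset.sum_congr rfl fun j hj => fracWeight_eq_mul_exp_logWeight hα.le hx0 hx1
      (Finset.mem_range_succ_iff.1 hj)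
  have hS : 0 < ∑ j ∈ Finset.range (n + 1), Real.exp (logWeight α x n (j : ℕ)) :=
    Finset.sum_pos (fun _ _ => Real.exp_pos _) (by simp)
  rw [fracBinomial, Measure.finsetSum_apply, Finset.sum_div, ENNReal.ofReal_sum_of_nonneg
    (fun _ _ => by positivity), Finset.sum_filter]
  refine Finset.sum_congr rfl fun j hj => ?_
  rw [Measure.smul_apply, Measure.dirac_apply' _ hA, hZ, fracWeight_eq_mul_exp_logWeight hα.le hx0
    hx1 (Finset.mem_range_succ_iff.1 hj), smul_eq_mul]
  by_cases h : (j : ℝ) ∈ A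
  · simp only [Set.indicator_of_mem h, Pi.one_apply, mul_one, Set.mem_preimage, h, if_true]
    congr 1
    field_simp
  · simp [h]

theorem isProbabilityMeasure_fracBinomial {α x : ℝ} (hα : 0 < α) (hx0 : 0 < x) (hx1 : x < 1)
    (n : ℕ) : IsProbabilityMeasure (fracBinomial α x n) := by
  have hS : 0 < ∑ j ∈ Finset.range (n + 1), Real.exp (logWeight α x n (j : ℕ)) :=
    Finset.sum_pos (fun _ _ => Real.exp_pos _) (by simp)
  constructor
  rw [fracBinomial_apply hα hx0 hx1 n .univ]
  simp [div_self hS.ne']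

/-- Comparison of the probabilities of two sets by a shift. -/
theorem fracBinomial_real_le_of_shift {α x : ℝ} (hα : 0 < α) (hx0 : 0 < x) (hx1 : x < 1) (n : ℕ)
    {A B : Set ℝ} (hA : MeasurableSet A) (hB : MeasurableSet B) (k : ℤ) (L : ℝ)
    (h : ∀ j : ℕ, j ≤ n → (j : ℝ) ∈ A → (0 : ℝ) ≤ j + k ∧ (j + k : ℝ) ≤ n ∧ (j + k : ℝ) ∈ B ∧
      logWeight α x n j ≤ L + logWeight α x n (j + k)) :
    (fracBinomial α x n).real A ≤ Real.exp L * (fracBinomial α x n).real B := by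
  classical
  rw [Measure.real, Measure.real, fracBinomial_apply hα hx0 hx1 n hA,
    fracBinomial_apply hα hx0 hx1 n hB, ENNReal.toReal_ofReal (by positivity),
    ENNReal.toReal_ofReal (by positivity), ← mul_div_assoc]
  gcongr
  have cast : ∀ j ∈ (Finset.range (n + 1)).filter (fun j : ℕ => j ∈ ((↑) ⁻¹' A : Set ℕ)),
      (((j + k : ℤ).toNat : ℕ) : ℝ) = j + k := fun j hj => by
    obtain ⟨h1, h2⟩ := Finset.mem_filter.1 hj
    have h0 : (0 : ℤ) ≤ j + k := by
      exact_mod_cast (h j (Finset.mem_range_succ_iff.1 h1) h2).1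
    rw [← Int.cast_natCast, Int.toNat_of_nonneg h0]
    push_cast
    rfl
  rw [Finset.mul_sum]
  calc _ ≤ ∑ j ∈ Finset.range (n + 1) with (j : ℕ) ∈ ((↑) ⁻¹' A : Set ℕ),
        Real.exp L * Real.exp (logWeight α x n ((j + k : ℤ).toNat : ℕ)) := by
        refine Finset.sum_le_sum fun j hj => ?_
        obtain ⟨h1, h2⟩ := Finset.mem_filter.1 hj
        rw [cast j hj, ← Real.exp_add]
        exact Real.exp_le_exp.2 (h j (Finset.mem_range_succ_iff.1 h1) h2).2.2.2
    -- The shift is injective: `toNat` truncates nothing, since `j + k` is nonnegative on `A`.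
    _ = ∑ i ∈ ((Finset.range (n + 1)).filter (fun j : ℕ => j ∈ ((↑) ⁻¹' A : Set ℕ))).image
        (fun j : ℕ => (j + k : ℤ).toNat), Real.exp L * Real.exp (logWeight α x n (i : ℕ)) := by
        rw [Finset.sum_image]
        intro i hi j hj hij
        have e := congrArg (Nat.cast (R := ℝ)) hij
        simp only at e
        rw [cast i hi, cast j hj] at e
        exact_mod_cast add_right_cancel e
    _ ≤ _ := by
        refine Finset.sum_le_sum_of_subset_of_nonneg ?_ fun _ _ _ => by positivity
        intro i hi
        obtain ⟨j, hj, rfl⟩ := Finset.mem_image.1 hi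
        obtain ⟨h1, h2⟩ := Finset.mem_filter.1 hj
        have h3 := h j (Finset.mem_range_succ_iff.1 h1) h2
        have e := cast j hj
        refine Finset.mem_filter.2 ⟨Finset.mem_range_succ_iff.2 ?_, ?_⟩
        · exact_mod_cast e.trans_le h3.2.1
        · simp only [Set.mem_preimage]
          rw [e]
          exact h3.2.2.1

/-! ### Gaussian tail bounds -/

/-- The slack of `1` allows `|v| = ⌊z * c n⌋`; it costs only `O(c n / n)`, which is absorbed in `δ`.
-/
theorem eventually_logWeight_shift_le {α x : ℝ} (hα : 0 < α) (hx0 : 0 < x) (hx1 : x < 1)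
    {c : ℕ → ℝ} (hc_n : Tendsto (fun n : ℕ => c n / (n : ℝ)) atTop (𝓝 0))
    (hc_sqrt : Tendsto (fun n : ℕ => c n / √(n : ℝ)) atTop atTop) {z δ : ℝ} (hz : 0 < z)
    (hδ : 0 < δ) :
    ∀ᶠ n : ℕ in atTop, ∀ v : ℝ, z * c n - 1 ≤ |v| → |v| ≤ z * c n →
      logWeight α x n (n * x + v) - logWeight α x n (n * x)
        ≤ (-(α / (2 * x * (1 - x)) * z ^ 2) + δ) * (c n ^ 2 / n) := by
  have hx1' : 0 < 1 - x := by linarith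
  have hc := tendsto_atTop_of_div_sqrt hc_sqrt
  set β := α / (2 * x * (1 - x)) with hβ
  have hβ0 : 0 < β := by positivity
  filter_upwards [eventually_abs_logWeight_sub_add_sq_le hα hx0 hx1 hc_n hc_sqrt hz (half_pos hδ),
    hc.eventually_ge_atTop (1 / z), hc.eventually_ge_atTop (4 * β * z / δ),
    hc.eventually_gt_atTop 0, eventually_gt_atTop 0] with n h1 h2 h3 h4 hn v hv1 hv2
  have hn' : (0 : ℝ) < n := by exact_mod_cast hn
  have h := (abs_le.1 (h1 v hv2).2.2).2
  rw [div_le_iff₀ hz] at h2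
  rw [div_le_iff₀ hδ] at h3
  have hsq : (z * c n - 1) ^ 2 ≤ v ^ 2 := by
    rw [← sq_abs v]
    exact pow_le_pow_left₀ (by linarith) hv1 2
  have hsq' : β * (z ^ 2 * c n ^ 2 - 2 * z * c n) ≤ β * v ^ 2 := by
    gcongr
    nlinarith
  have hlin : β * (2 * z * c n) ≤ δ / 2 * c n ^ 2 := by nlinarith
  have : (β * z ^ 2 - δ / 2) * (c n ^ 2 / n) ≤ β * (v ^ 2 / n) := by
    rw [← mul_div_assoc, ← mul_div_assoc]
    exact div_le_div_of_nonneg_right (by linarith) hn'.le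
  linarith

theorem eventually_fracBinomial_right_tail_le {α x : ℝ} (hα : 0 < α) (hx0 : 0 < x) (hx1 : x < 1)
    {c : ℕ → ℝ} (hc_n : Tendsto (fun n : ℕ => c n / (n : ℝ)) atTop (𝓝 0))
    (hc_sqrt : Tendsto (fun n : ℕ => c n / √(n : ℝ)) atTop atTop) {z δ : ℝ} (hz : 0 < z)
    (hδ : 0 < δ) :
    ∀ᶠ n : ℕ in atTop, (fracBinomial α x n).real {s | z * c n ≤ s - n * x}
      ≤ Real.exp ((-(α / (2 * x * (1 - x)) * z ^ 2) + δ) * (c n ^ 2 / n)) := by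
  have hc := tendsto_atTop_of_div_sqrt hc_sqrt
  filter_upwards [eventually_logWeight_shift_le hα hx0 hx1 hc_n hc_sqrt hz hδ,
    hc.eventually_gt_atTop 0] with n h1 hcn
  have hp := isProbabilityMeasure_fracBinomial hα hx0 hx1 n
  have hk0 : (0 : ℝ) ≤ ⌊z * c n⌋ := by exact_mod_cast Int.floor_nonneg.2 (by positivity)
  have hk1 := Int.floor_le (z * c n)
  have hk2 := Int.lt_floor_add_one (z * c n)
  have hL := h1 ⌊z * c n⌋ (by rw [abs_of_nonneg hk0]; linarith) (by rwa [abs_of_nonneg hk0])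
  have hnx : 0 ≤ n * x := by positivity
  refine (fracBinomial_real_le_of_shift hα hx0 hx1 n (measurableSet_le (by fun_prop) (by fun_prop))
    .univ (-⌊z * c n⌋) _ ?_).trans (by rw [probReal_univ, mul_one])
  intro j hj hjA
  simp only [Set.mem_ofPred_eq] at hjA
  have hj' : (j : ℝ) ≤ n := by exact_mod_cast hj
  -- Rounding down gives `j - ⌊z * c n⌋ ≥ n * x`, the ordering that concavity needs.
  have h4 := logWeight_add_le_add_of_shift (x := x) (n := n) (a := n * x)
    (b := j + -⌊z * c n⌋) (k := ⌊z * c n⌋) hα.le hnx (by linarith) (by linarith) hk0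
  rw [neg_add_cancel_right] at h4
  push_cast
  exact ⟨by linarith, by linarith, trivial, by linarith⟩

theorem eventually_fracBinomial_left_tail_le {α x : ℝ} (hα : 0 < α) (hx0 : 0 < x) (hx1 : x < 1)
    {c : ℕ → ℝ} (hc_n : Tendsto (fun n : ℕ => c n / (n : ℝ)) atTop (𝓝 0))
    (hc_sqrt : Tendsto (fun n : ℕ => c n / √(n : ℝ)) atTop atTop) {z δ : ℝ} (hz : 0 < z)
    (hδ : 0 < δ) :
    ∀ᶠ n : ℕ in atTop, (fracBinomial α x n).real {s | z * c n ≤ n * x - s}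
      ≤ Real.exp ((-(α / (2 * x * (1 - x)) * z ^ 2) + δ) * (c n ^ 2 / n)) := by
  have hc := tendsto_atTop_of_div_sqrt hc_sqrt
  filter_upwards [eventually_logWeight_shift_le hα hx0 hx1 hc_n hc_sqrt hz hδ,
    hc.eventually_gt_atTop 0] with n h1 hcn
  have hp := isProbabilityMeasure_fracBinomial hα hx0 hx1 n
  have hk0 : (0 : ℝ) ≤ ⌊z * c n⌋ := by exact_mod_cast Int.floor_nonneg.2 (by positivity)
  have hk1 := Int.floor_le (z * c n)
  have hk2 := Int.lt_floor_add_one (z * c n)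
  have hL := h1 (-⌊z * c n⌋) (by rw [abs_neg, abs_of_nonneg hk0]; linarith)
    (by rwa [abs_neg, abs_of_nonneg hk0])
  have hnx : n * x ≤ n := mul_le_of_le_one_right n.cast_nonneg hx1.le
  refine (fracBinomial_real_le_of_shift hα hx0 hx1 n (measurableSet_le (by fun_prop) (by fun_prop))
    .univ ⌊z * c n⌋ _ ?_).trans (by rw [probReal_univ, mul_one])
  intro j hj hjA
  simp only [Set.mem_ofPred_eq] at hjA
  have hj' : (0 : ℝ) ≤ j := j.cast_nonneg
  have h4 := logWeight_add_le_add_of_shift (x := x) (n := n) (a := j)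
    (b := n * x + -⌊z * c n⌋) (k := ⌊z * c n⌋) hα.le hj' (by linarith) (by linarith) hk0
  rw [neg_add_cancel_right] at h4
  exact ⟨by linarith, by linarith, trivial, by linarith⟩

theorem eventually_fracBinomial_tail_le {α x : ℝ} (hα : 0 < α) (hx0 : 0 < x) (hx1 : x < 1)
    {c : ℕ → ℝ} (hc_n : Tendsto (fun n : ℕ => c n / (n : ℝ)) atTop (𝓝 0))
    (hc_sqrt : Tendsto (fun n : ℕ => c n / √(n : ℝ)) atTop atTop) {z δ : ℝ} (hz : 0 < z)
    (hδ : 0 < δ) :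
    ∀ᶠ n : ℕ in atTop, (fracBinomial α x n).real {s | z * c n ≤ |s - n * x|}
      ≤ Real.exp ((-(α / (2 * x * (1 - x)) * z ^ 2) + δ) * (c n ^ 2 / n)) := by
  filter_upwards [eventually_fracBinomial_right_tail_le hα hx0 hx1 hc_n hc_sqrt hz (half_pos hδ),
    eventually_fracBinomial_left_tail_le hα hx0 hx1 hc_n hc_sqrt hz (half_pos hδ),
    -- The factor `2` from the two tails is paid for by half of `δ`.
    ((tendsto_sq_div_atTop hc_sqrt).const_mul_atTop (half_pos hδ)).eventually_ge_atTop
      (Real.log 2)] with n h1 h2 h3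
  have hp := isProbabilityMeasure_fracBinomial hα hx0 hx1 n
  have hsub : {s | z * c n ≤ |s - n * x|}
      ⊆ {s | z * c n ≤ s - n * x} ∪ {s | z * c n ≤ n * x - s} := fun s hs => by
    rcases le_abs.1 (show z * c n ≤ |s - n * x| from hs) with h | h
    · exact Or.inl h
    · exact Or.inr (by rwa [neg_sub] at h)
  set β := α / (2 * x * (1 - x))
  calc _ ≤ _ := (measureReal_mono hsub).trans (measureReal_union_le _ _)
    _ ≤ 2 * Real.exp ((-(β * z ^ 2) + δ / 2) * (c n ^ 2 / n)) := by linarith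
    _ ≤ Real.exp (δ / 2 * (c n ^ 2 / n)) * Real.exp ((-(β * z ^ 2) + δ / 2) * (c n ^ 2 / n)) := by
        gcongr
        rwa [← Real.log_le_iff_le_exp (by norm_num)]
    _ = _ := by
        rw [← Real.exp_add]
        congr 1
        ring

/-! ### Concentration and lower bounds on intervals -/

theorem eventually_half_le_fracBinomial {α x : ℝ} (hα : 0 < α) (hx0 : 0 < x) (hx1 : x < 1)
    {c : ℕ → ℝ} (hc_n : Tendsto (fun n : ℕ => c n / (n : ℝ)) atTop (𝓝 0))
    (hc_sqrt : Tendsto (fun n : ℕ => c n / √(n : ℝ)) atTop atTop) {ε : ℝ} (hε : 0 < ε) :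
    ∀ᶠ n : ℕ in atTop, 1 / 2 ≤ (fracBinomial α x n).real {s | |s - n * x| < ε * c n} := by
  have hx1' : 0 < 1 - x := by linarith
  set β := α / (2 * x * (1 - x)) with hβ
  have hδ : 0 < β * ε ^ 2 / 2 := by positivity
  filter_upwards [eventually_fracBinomial_tail_le hα hx0 hx1 hc_n hc_sqrt hε hδ,
    ((tendsto_sq_div_atTop hc_sqrt).const_mul_atTop hδ).eventually_ge_atTop
      (Real.log 2)] with n h1 h2
  have hp := isProbabilityMeasure_fracBinomial hα hx0 hx1 n
  have hcompl : {s : ℝ | |s - n * x| < ε * c n} = {s | ε * c n ≤ |s - n * x|}ᶜ := by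
    ext s
    simp
  rw [hcompl, probReal_compl_eq_one_sub (measurableSet_le (by fun_prop) (by fun_prop))]
  have : Real.exp ((-(β * ε ^ 2) + β * ε ^ 2 / 2) * (c n ^ 2 / n)) ≤ 1 / 2 := by
    rw [← Real.le_log_iff_exp_le (by norm_num), one_div, Real.log_inv]
    linarith
  linarith

theorem eventually_le_fracBinomial_interval {α x : ℝ} (hα : 0 < α) (hx0 : 0 < x) (hx1 : x < 1)
    {c : ℕ → ℝ} (hc_n : Tendsto (fun n : ℕ => c n / (n : ℝ)) atTop (𝓝 0))
    (hc_sqrt : Tendsto (fun n : ℕ => c n / √(n : ℝ)) atTop atTop) (z : ℝ) {ε δ : ℝ} (hε : 0 < ε)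
    (hδ : 0 < δ) :
    ∀ᶠ n : ℕ in atTop, Real.exp ((-(α / (2 * x * (1 - x)) * z ^ 2) - δ) * (c n ^ 2 / n))
      ≤ (fracBinomial α x n).real {s | |s - n * x - z * c n| < ε * c n} := by
  have hx1' : 0 < 1 - x := by linarith
  have hc := tendsto_atTop_of_div_sqrt hc_sqrt
  set β := α / (2 * x * (1 - x)) with hβ
  have hβ0 : 0 < β := by positivity
  -- The window and the rounding of `z * c n` each use `η * c n`, hence `ε / 2`. As `η ≤ 1`, the
  -- excess in `(v + k) ^ 2 - v ^ 2` over `z ^ 2 * c n ^ 2` is at most `η * (4 * |z| + 3) * c n ^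
  -- 2`, which the last term makes cost at most `δ / 4`. Two expansion errors `δ / 8` complete `δ /
  -- 2`; the other half pays for the mass `1 / 2`.
  set η := min (min 1 (ε / 2)) (δ / (4 * β * (4 * |z| + 3))) with hη
  have hη0 : 0 < η := by positivity
  have hη1 : η ≤ 1 := (min_le_left _ _).trans (min_le_left _ _)
  have hη2 : η ≤ ε / 2 := (min_le_left _ _).trans (min_le_right _ _)
  have hη3 : β * (η * (4 * |z| + 3)) ≤ δ / 4 := by
    have : η ≤ δ / (4 * β * (4 * |z| + 3)) := min_le_right _ _
    rw [le_div_iff₀ (by positivity)] at this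
    linarith
  filter_upwards [eventually_half_le_fracBinomial hα hx0 hx1 hc_n hc_sqrt hη0,
    eventually_abs_logWeight_sub_add_sq_le hα hx0 hx1 hc_n hc_sqrt
      (show 0 < |z| + 2 * η by positivity) (show 0 < δ / 8 by positivity),
    ((tendsto_sq_div_atTop hc_sqrt).const_mul_atTop (half_pos hδ)).eventually_ge_atTop
      (Real.log 2), hc.eventually_gt_atTop 0, hc.eventually_ge_atTop (1 / η),
    eventually_gt_atTop 0] with n h1 h2 h3 hcn h4 hn
  have hn' : (0 : ℝ) < n := by exact_mod_cast hn
  rw [div_le_iff₀' hη0] at h4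
  set k := ⌊z * c n⌋ with hk
  have hk1 : (k : ℝ) ≤ z * c n := Int.floor_le _
  have hk2 : z * c n < k + 1 := Int.lt_floor_add_one _
  have hkz : |(k : ℝ) - z * c n| ≤ η * c n := by
    rw [abs_le]
    constructor <;> linarith
  have hka : |(k : ℝ)| ≤ (|z| + η) * c n := by
    calc |(k : ℝ)| = |(k - z * c n) + z * c n| := by rw [sub_add_cancel]
      _ ≤ |k - z * c n| + |z * c n| := abs_add_le _ _
      _ ≤ η * c n + |z| * c n := by
          rw [abs_mul z, abs_of_pos hcn]
          gcongr
      _ = _ := by ring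
  have hηε : η * c n + η * c n ≤ ε * c n := by nlinarith
  have key := fracBinomial_real_le_of_shift hα hx0 hx1 n
    (A := {s | |s - n * x| < η * c n}) (B := {s | |s - n * x - z * c n| < ε * c n})
    (measurableSet_lt (by fun_prop) (by fun_prop)) (measurableSet_lt (by fun_prop) (by fun_prop)) k
    ((β * z ^ 2 + δ / 2) * (c n ^ 2 / n)) ?_
  · have hlog : Real.exp (-(δ / 2 * (c n ^ 2 / n))) ≤ 1 / 2 := by
      rw [← Real.le_log_iff_exp_le (by norm_num), one_div, Real.log_inv]
      linarith
    set m := (fracBinomial α x n).real {s | |s - n * x - z * c n| < ε * c n}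
    calc Real.exp ((-(β * z ^ 2) - δ) * (c n ^ 2 / n))
        = Real.exp (-((β * z ^ 2 + δ / 2) * (c n ^ 2 / n)))
          * Real.exp (-(δ / 2 * (c n ^ 2 / n))) := by
          rw [← Real.exp_add]
          congr 1
          ring
      _ ≤ Real.exp (-((β * z ^ 2 + δ / 2) * (c n ^ 2 / n)))
          * (Real.exp ((β * z ^ 2 + δ / 2) * (c n ^ 2 / n)) * m) := by
          gcongr
          linarith
      _ = m := by rw [← mul_assoc, ← Real.exp_add, neg_add_cancel, Real.exp_zero, one_mul]
  · intro j hj hjA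
    simp only [Set.mem_ofPred_eq] at hjA ⊢
    set v : ℝ := j - n * x with hv
    have hjv : (j : ℝ) = n * x + v := by rw [hv]; ring
    have hjv' : (j : ℝ) + k = n * x + (v + k) := by rw [hv]; ring
    have hv1 : |v| ≤ (|z| + 2 * η) * c n := by nlinarith [abs_nonneg z]
    have hv2 : |v + k| ≤ (|z| + 2 * η) * c n := by
      linarith [abs_add_le v k]
    obtain ⟨-, -, e1⟩ := h2 v hv1
    obtain ⟨r1, r2, e2⟩ := h2 (v + k) hv2
    have e1' := (abs_le.1 e1).2
    have e2' := (abs_le.1 e2).1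
    obtain ⟨r1, -⟩ := abs_le.1 r1
    obtain ⟨-, r2⟩ := abs_le.1 r2
    have hnx : 0 < n * x := by positivity
    have hnx' : 0 < n * (1 - x) := by positivity
    refine ⟨by linarith, by linarith, ?_, ?_⟩
    · rw [show (j : ℝ) + k - n * x - z * c n = v + (k - z * c n) by rw [hv]; ring]
      linarith [abs_add_le v (k - z * c n)]
    · have hkk : (k : ℝ) ^ 2 ≤ ((|z| + η) * c n) ^ 2 := by
        rw [← sq_abs (k : ℝ)]
        gcongr
      have hvk : v * k ≤ (η * c n) * ((|z| + η) * c n) :=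
        (le_abs_self _).trans (by rw [abs_mul]; gcongr)
      have hquad : (v + k) ^ 2 - v ^ 2 ≤ (z ^ 2 + η * (4 * |z| + 3)) * c n ^ 2 := by
        have : (z ^ 2 + (4 * η * |z| + 3 * η * η)) * c n ^ 2
            ≤ (z ^ 2 + η * (4 * |z| + 3)) * c n ^ 2 := by
          gcongr
          nlinarith
        have hz := sq_abs z
        rw [← hz] at this ⊢
        linarith
      have hquad' : β * ((v + k) ^ 2 / n) - β * (v ^ 2 / n)
          ≤ (β * z ^ 2 + δ / 4) * (c n ^ 2 / n) := by
        calc β * ((v + k) ^ 2 / n) - β * (v ^ 2 / n) = β * (((v + k) ^ 2 - v ^ 2) / n) := by ring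
          _ ≤ β * ((z ^ 2 + η * (4 * |z| + 3)) * c n ^ 2 / n) := by gcongr
          _ = (β * z ^ 2 + β * (η * (4 * |z| + 3))) * (c n ^ 2 / n) := by ring
          _ ≤ _ := by gcongr
      rw [hjv', hjv]
      linarith

/-! ### From Gaussian bounds to the large deviation principle -/

theorem inv_mul_log_ofReal_exp {a t : ℝ} (ha : 0 < a) :
    ((1 / a : ℝ) : EReal) * ENNReal.log (ENNReal.ofReal (Real.exp (t * a))) = (t : EReal) := by
  rw [ENNReal.log_ofReal_of_pos (Real.exp_pos _), Real.log_exp, ← EReal.coe_mul]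
  congr 1
  field_simp

/-- A large deviation principle with quadratic rate function follows from Gaussian tail estimates
and Gaussian lower bounds for the probabilities of intervals. -/
theorem satisfiesLDP_of_gaussian_bounds {μ : ℕ → Measure ℝ} {a : ℕ → ℝ} {β : ℝ} (hβ : 0 ≤ β)
    (hμ : ∀ n, 1 ≤ n → IsProbabilityMeasure (μ n)) (ha : ∀ n, 1 ≤ n → 0 < a n)
    (ha_top : Tendsto a atTop atTop)
    (hup : ∀ d > 0, ∀ δ > 0, ∀ᶠ n in atTop,
      (μ n).real {y | d ≤ |y|} ≤ Real.exp ((-(β * d ^ 2) + δ) * a n))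
    (hlow : ∀ z, ∀ ε > 0, ∀ δ > 0, ∀ᶠ n in atTop,
      Real.exp ((-(β * z ^ 2) - δ) * a n) ≤ (μ n).real {y | |y - z| < ε}) :
    SatisfiesLDP μ a (fun z => ENNReal.ofReal (β * z ^ 2)) where
  isProbabilityMeasure := hμ
  speed_pos := ha
  speed_tendsto := ha_top
  lowerSemicontinuous := by
    refine Continuous.lowerSemicontinuous ?_
    exact ENNReal.continuous_ofReal.comp (by fun_prop)
  upper_bound F hF := by
    rcases F.eq_empty_or_nonempty with rfl | hne
    · refine (limsup_le_of_le (a := ⊥) (by isBoundedDefault) ?_).trans bot_le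
      filter_upwards [eventually_ge_atTop 1] with n hn
      have := ha n hn
      rw [measure_empty, ENNReal.log_zero, EReal.coe_mul_bot_of_pos (by positivity)]
    -- A point of `F` nearest to `0` minimizes the rate function, and `F` lies in the two-sided tail
    -- it determines.
    obtain ⟨y, hy, hd⟩ := hF.exists_infDist_eq_dist hne 0
    have hd' : Metric.infDist 0 F = |y| := by rw [hd, dist_comm, Real.dist_0_eq_abs]
    have hsub : F ⊆ {z | |y| ≤ |z|} := fun z hz => by
      have := Metric.infDist_le_dist_of_mem (x := 0) hz
      rwa [hd', dist_comm, Real.dist_0_eq_abs] at this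
    have hI : ((-(β * y ^ 2) : ℝ) : EReal) ≤ -(⨅ z ∈ F, ((ENNReal.ofReal (β * z ^ 2)) : EReal)) := by
      rw [EReal.coe_neg, EReal.neg_le_neg_iff]
      refine (iInf₂_le y hy).trans ?_
      rw [EReal.coe_ennreal_ofReal, max_eq_left (by positivity)]
    refine le_trans ?_ hI
    refine EReal.le_of_forall_lt_iff_le.1 fun t ht => ?_
    have ht' := EReal.coe_lt_coe_iff.1 ht
    refine limsup_le_of_le (by isBoundedDefault) ?_
    have hev : ∀ᶠ n in atTop, (μ n).real F ≤ Real.exp (t * a n) := by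
      -- The tail bound requires `d > 0`; for `y = 0` one has `t > 0`, and probability at most `1`
      -- suffices.
      rcases eq_or_ne y 0 with rfl | hy0
      · filter_upwards [eventually_ge_atTop 1] with n hn
        have := hμ n hn
        have := ha n hn
        refine measureReal_le_one.trans (Real.one_le_exp ?_)
        have : 0 < t := by simpa using ht'
        positivity
      · filter_upwards [hup |y| (abs_pos.2 hy0) (t + β * y ^ 2) (by linarith),
          eventually_ge_atTop 1] with n h1 hn
        have := hμ n hn
        rw [sq_abs] at h1
        refine ((measureReal_mono hsub).trans h1).trans (le_of_eq ?_)
        congr 2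
        ring
    filter_upwards [hev, eventually_ge_atTop 1] with n h1 hn
    have := hμ n hn
    have han := ha n hn
    rw [← inv_mul_log_ofReal_exp (t := t) han]
    refine mul_le_mul_of_nonneg_left (ENNReal.log_le_log ?_)
      (EReal.coe_nonneg.2 (by positivity))
    rw [← ofReal_measureReal]
    exact ENNReal.ofReal_le_ofReal h1
  lower_bound G hG := by
    rw [EReal.neg_le]
    refine le_iInf₂ fun z hz => ?_
    rw [EReal.neg_le, EReal.coe_ennreal_ofReal, max_eq_left (by positivity), ← EReal.coe_neg]
    refine EReal.ge_of_forall_gt_iff_ge.1 fun t ht => ?_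
    have ht' := EReal.coe_lt_coe_iff.1 ht
    obtain ⟨ε, hε, hball⟩ := Metric.isOpen_iff.1 hG z hz
    refine le_liminf_of_le (by isBoundedDefault) ?_
    filter_upwards [hlow z ε hε (-(β * z ^ 2) - t) (by linarith), eventually_ge_atTop 1]
      with n h1 hn
    have := hμ n hn
    have han := ha n hn
    rw [sub_sub_cancel] at h1
    rw [← inv_mul_log_ofReal_exp (t := t) han]
    refine mul_le_mul_of_nonneg_left (ENNReal.log_le_log ?_)
      (EReal.coe_nonneg.2 (by positivity))
    rw [← ofReal_measureReal]
    refine ENNReal.ofReal_le_ofReal (h1.trans (measureReal_mono ?_))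
    intro y hy
    exact hball (by simpa [Real.dist_eq] using hy)

end

theorem theorem2p4 (α x : ℝ) (hα : 0 < α) (hx0 : 0 < x) (hx1 : x < 1)
    (c : ℕ → ℝ) (hc : ∀ n, 1 ≤ n → 0 < c n)
    (hc_n : Tendsto (fun n : ℕ => c n / (n : ℝ)) atTop (𝓝 0))
    (hc_sqrt : Tendsto (fun n : ℕ => c n / √(n : ℝ)) atTop atTop)
    {Ω : ℕ → Type*} [∀ n, MeasurableSpace (Ω n)] (P : ∀ n, Measure (Ω n))
    (S : ∀ n, Ω n → ℝ)
    (hS : ∀ n, 1 ≤ n → HasLaw (S n) (fracBinomial α x n) (P n)) :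
    SatisfiesLDP
      (fun n => (P n).map (fun ω => (S n ω - n * x) / c n))
      (fun n => c n ^ 2 / n)
      (fun z => ENNReal.ofReal (α / (2 * x * (1 - x)) * z ^ 2)) := by
  have hx1' : 0 < 1 - x := by linarith
  have hmap : ∀ n, 1 ≤ n → (P n).map (fun ω => (S n ω - n * x) / c n)
      = (fracBinomial α x n).map (fun s => (s - n * x) / c n) := fun n hn => by
    rw [← (hS n hn).map_eq, AEMeasurable.map_map_of_aemeasurable (by fun_prop)
      (hS n hn).aemeasurable]
    rfl
  refine satisfiesLDP_of_gaussian_bounds (by positivity) (fun n hn => ?_) (fun n hn => ?_)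
    (tendsto_sq_div_atTop hc_sqrt) (fun d hd δ hδ => ?_) (fun z ε hε δ hδ => ?_)
  · have := isProbabilityMeasure_fracBinomial hα hx0 hx1 n
    rw [hmap n hn]
    exact Measure.isProbabilityMeasure_map (by fun_prop)
  · have := hc n hn
    have : (0 : ℝ) < n := by exact_mod_cast hn
    positivity
  · filter_upwards [eventually_fracBinomial_tail_le hα hx0 hx1 hc_n hc_sqrt hd hδ,
      eventually_ge_atTop 1] with n h hn
    have hcn := hc n hn
    rw [hmap n hn, map_measureReal_apply (by fun_prop)
      (measurableSet_le (by fun_prop) (by fun_prop))]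
    convert h using 3
    ext s
    simp [abs_div, abs_of_pos hcn, le_div_iff₀ hcn]
  · filter_upwards [eventually_le_fracBinomial_interval hα hx0 hx1 hc_n hc_sqrt z hε hδ,
      eventually_ge_atTop 1] with n h hn
    have hcn := hc n hn
    rw [hmap n hn, map_measureReal_apply (by fun_prop)
      (measurableSet_lt (by fun_prop) (by fun_prop))]
    convert h using 3
    ext s
    simp only [Set.preimage_ofPred_eq, Set.mem_ofPred_eq]
    rw [show (s - n * x) / c n - z = (s - n * x - z * c n) / c n by field_simp, abs_div,
      abs_of_pos hcn, div_lt_iff₀ hcn]
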